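/- For $n\ge 1$ let $V_n$ be the real vector space of functions $f$ on the unit circle of the form $$f(\theta)=a_0+\sum_{k=1}^n\bigl(a_k\cos k\theta+b_k\sin k\theta\bigr),\qquad a_k,b_k\in\mathbb{R},$$ with the inner product $(f,g)=\frac1{2\pi}\int_0^{2\pi}f(\theta)g(\theta)\,d\theta$, let $S(V_n)$ be its unit sphere and $dS$ the area measure on $S(V_n)$ induced by this inner product. For $f\in S(V_n)$ let $\mu(f)$ be the number of critical points of $f$ on the unit circle, that is, of points of the circle where $df/d\theta=0$. Then, for every $n\ge1$, $\mu(f)$ is finite for almost all $f\in S(V_n)$, it is integrable over $S(V_n)$, and its expected value $$T_n:=\frac{1}{\operatorname{area}(S(V_n))}\int_{S(V_n)}\mu(f)\,dS(f)$$ is $$T_n=2\sqrt{\frac{\sum_{k=1}^nk^4}{\sum_{k=1}^nk^2}}=2\sqrt{\frac{3\,\beta_5(n+1)}{5\,\beta_3(n+1)}},$$ where $\beta_j$ is the $j$-th Bernoulli polynomial. In particular $T_n\sim 2n\sqrt{3/5}$ as $n\to\infty$, i.e. the quotient of the two sides tends to $1$. -/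

import Mathlib

open Real MeasureTheory Filter
open scoped Topology

namespace RandomTrig

noncomputable section

/-- The trigonometric polynomials of degree at most `n`: the functions `f` on the unit circle with
`f(e^{iθ}) = a₀ + ∑_{k=1}^n (a_k cos kθ + b_k sin kθ)` for some real coefficients. -/
def trigSubmodule (n : ℕ) : Submodule ℝ (Circle → ℝ) where
  carrier := {f | ∃ a b : ℕ → ℝ, ∀ θ : ℝ, f (Circle.exp θ) =
    a 0 + ∑ k ∈ Finset.Icc 1 n, (a k * Real.cos (k * θ) + b k * Real.sin (k * θ))}
  add_mem' := by
    rintro f g ⟨a, b, hf⟩ ⟨c, d, hg⟩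
    refine ⟨a + c, b + d, fun θ => ?_⟩
    simp only [Pi.add_apply, hf, hg, Finset.sum_add_distrib, add_mul]
    ring
  zero_mem' := ⟨0, 0, fun θ => by simp⟩
  smul_mem' := by
    rintro r f ⟨a, b, hf⟩
    refine ⟨r • a, r • b, fun θ => ?_⟩
    simp only [Pi.smul_apply, smul_eq_mul, hf, mul_add, Finset.mul_sum, mul_assoc]

/-- The vector space `V_n` of trigonometric polynomials of degree at most `n` (a type of its own, so
that it carries the topology of its `L²` norm and no other one). -/
def TrigPoly (n : ℕ) : Type := trigSubmodule n

instance (n : ℕ) : AddCommGroup (TrigPoly n) := inferInstanceAs (AddCommGroup (trigSubmodule n))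

instance (n : ℕ) : Module ℝ (TrigPoly n) := inferInstanceAs (Module ℝ (trigSubmodule n))

/-- The function on the unit circle that an element of `V_n` is. -/
def TrigPoly.toFun {n : ℕ} (f : TrigPoly n) : Circle → ℝ := Subtype.val (p := (· ∈ trigSubmodule n)) f

instance (n : ℕ) : CoeFun (TrigPoly n) (fun _ => Circle → ℝ) := ⟨TrigPoly.toFun⟩

theorem TrigPoly.ext {n : ℕ} {f g : TrigPoly n} (h : ∀ z, f z = g z) : f = g :=
  Subtype.ext (funext h)

@[simp] theorem TrigPoly.add_apply {n : ℕ} (f g : TrigPoly n) (z : Circle) :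
    (f + g) z = f z + g z := rfl

@[simp] theorem TrigPoly.smul_apply {n : ℕ} (r : ℝ) (f : TrigPoly n) (z : Circle) :
    (r • f) z = r * f z := rfl

@[simp] theorem TrigPoly.zero_apply {n : ℕ} (z : Circle) : (0 : TrigPoly n) z = 0 := rfl

theorem TrigPoly.continuous_exp {n : ℕ} (f : TrigPoly n) :
    Continuous (fun θ : ℝ => f (Circle.exp θ)) := by
  obtain ⟨a, b, h⟩ := f.2
  have h' : (fun θ : ℝ => f (Circle.exp θ)) = fun θ : ℝ =>
      a 0 + ∑ k ∈ Finset.Icc 1 n, (a k * Real.cos (k * θ) + b k * Real.sin (k * θ)) := funext h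
  rw [h']
  fun_prop

/-- The inner product `(f, g) = (1/2π) ∫₀^{2π} f(θ) g(θ) dθ` on `V_n`. -/
instance (n : ℕ) : Inner ℝ (TrigPoly n) where
  inner f g := (2 * π)⁻¹ * ∫ θ in (0 : ℝ)..(2 * π), f (Circle.exp θ) * g (Circle.exp θ)

theorem TrigPoly.inner_def {n : ℕ} (f g : TrigPoly n) : inner ℝ f g =
    (2 * π)⁻¹ * ∫ θ in (0 : ℝ)..(2 * π), f (Circle.exp θ) * g (Circle.exp θ) := rfl

theorem TrigPoly.eq_zero_of_inner_self {n : ℕ} (f : TrigPoly n) (h : inner ℝ f f = 0) :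
    f = 0 := by
  have hpi := Real.pi_pos
  have hc := f.continuous_exp
  rw [TrigPoly.inner_def, mul_eq_zero, or_iff_right (by positivity)] at h
  by_contra hne
  obtain ⟨z, hz⟩ : ∃ z, f z ≠ 0 := by
    by_contra! hall
    exact hne (TrigPoly.ext hall)
  have hper : Function.Periodic (fun θ : ℝ => f (Circle.exp θ)) (2 * π) := fun θ => by
    simp only [Circle.periodic_exp θ]
  obtain ⟨t, ht⟩ : ∃ t : ℝ, Circle.exp t = z := ⟨Complex.arg (z : ℂ), Circle.exp_arg z⟩
  obtain ⟨y, hy, hyt⟩ := hper.exists_mem_Ico₀ (by positivity) t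
  have hpos := intervalIntegral.integral_pos (a := 0) (b := 2 * π)
    (f := fun θ : ℝ => f (Circle.exp θ) * f (Circle.exp θ)) (by positivity)
    (hc.mul hc).continuousOn (fun x _ => mul_self_nonneg _)
    ⟨y, ⟨hy.1, hy.2.le⟩, by
      have h1 : f (Circle.exp y) ≠ 0 := by
        have h2 : f (Circle.exp t) = f (Circle.exp y) := hyt
        rw [← h2, ht]; exact hz
      exact mul_self_pos.mpr h1⟩
  exact hpos.ne' h

instance trigCore (n : ℕ) : InnerProductSpace.Core ℝ (TrigPoly n) where
  conj_inner_symm f g := by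
    simp only [TrigPoly.inner_def, conj_trivial]
    congr 2
    ext θ
    ring
  re_inner_nonneg f := by
    have hpi := Real.pi_pos
    simp only [TrigPoly.inner_def, RCLike.re_to_real]
    refine mul_nonneg (by positivity) (intervalIntegral.integral_nonneg (by positivity) ?_)
    exact fun x _ => mul_self_nonneg _
  add_left f g h := by
    simp only [TrigPoly.inner_def, TrigPoly.add_apply, add_mul]
    rw [intervalIntegral.integral_add, mul_add]
    · exact (f.continuous_exp.mul h.continuous_exp).intervalIntegrable _ _
    · exact (g.continuous_exp.mul h.continuous_exp).intervalIntegrable _ _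
  smul_left f g r := by
    simp only [TrigPoly.inner_def, TrigPoly.smul_apply, conj_trivial, mul_assoc]
    rw [intervalIntegral.integral_const_mul]
    ring
  definite f h := f.eq_zero_of_inner_self h

instance (n : ℕ) : NormedAddCommGroup (TrigPoly n) :=
  (trigCore n).toNormedAddCommGroup

instance (n : ℕ) : InnerProductSpace ℝ (TrigPoly n) := InnerProductSpace.ofCore (trigCore n).toCore

instance (n : ℕ) : FiniteDimensional ℝ (TrigPoly n) := by
  let c : ℕ → Circle → ℝ := fun k z => Real.cos (k * Complex.arg z)
  let s : ℕ → Circle → ℝ := fun k z => Real.sin (k * Complex.arg (z : ℂ))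
  let S : Set (Circle → ℝ) := (c '' Set.Iic n) ∪ (s '' Set.Iic n)
  have hS : S.Finite := ((Set.finite_Iic n).image c).union ((Set.finite_Iic n).image s)
  have hle : trigSubmodule n ≤ Submodule.span ℝ S := by
    rintro f ⟨a, b, hf⟩
    have hfe : f = a 0 • c 0 + ∑ k ∈ Finset.Icc 1 n, (a k • c k + b k • s k) := by
      ext z
      have := hf (Complex.arg (z : ℂ))
      rw [Circle.exp_arg] at this
      simp [this, c, s, Finset.sum_apply]
    rw [hfe]
    have hcm : ∀ k ≤ n, c k ∈ Submodule.span ℝ S := fun k hk =>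
      Submodule.subset_span (Or.inl ⟨k, hk, rfl⟩)
    have hsm : ∀ k ≤ n, s k ∈ Submodule.span ℝ S := fun k hk =>
      Submodule.subset_span (Or.inr ⟨k, hk, rfl⟩)
    refine Submodule.add_mem _ (Submodule.smul_mem _ _ (hcm 0 (Nat.zero_le n)))
      (Submodule.sum_mem _ fun k hk => ?_)
    have hk' := (Finset.mem_Icc.mp hk).2
    exact Submodule.add_mem _ (Submodule.smul_mem _ _ (hcm k hk'))
      (Submodule.smul_mem _ _ (hsm k hk'))
  have := FiniteDimensional.span_of_finite ℝ hS
  exact Submodule.finiteDimensional_of_le hle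

instance (n : ℕ) : MeasurableSpace (TrigPoly n) := borel (TrigPoly n)

instance (n : ℕ) : BorelSpace (TrigPoly n) := ⟨rfl⟩

/-- The unit sphere `S(V_n)`. -/
abbrev UnitSphere (n : ℕ) : Type := Metric.sphere (0 : TrigPoly n) 1

/-- The area measure on `S(V_n)` that the Euclidean volume of `V_n` induces. -/
def area (n : ℕ) : Measure (UnitSphere n) := (volume : Measure (TrigPoly n)).toSphere

/-- The critical points of a function on the unit circle: the points `z` at which its derivative
along the arclength parametrization `t ↦ z e^{it}` of the circle vanishes. -/
def criticalPoints (f : Circle → ℝ) : Set Circle :=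
  {z | HasDerivAt (fun t : ℝ => f (z * Circle.exp t)) 0 0}

/-- The number of critical points on the unit circle of a point of `S(V_n)`. -/
def numCrit (n : ℕ) (f : UnitSphere n) : ℕ := (criticalPoints (f : TrigPoly n)).ncard

/-- The expected number of critical points: `(1 / area S(V_n)) ∫_{S(V_n)} numCrit(f) dS(f)`. -/
def expectedNumCrit (n : ℕ) : ℝ :=
  ((area n).real Set.univ)⁻¹ * ∫ f, (numCrit n f : ℝ) ∂(area n)

end

end RandomTrig

/-! For each `t` the map `f ↦ f'(t)` is the inner product with a vector `derivKernel n t` of `V_n`,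
so critical points of `f` are zeros of `t ↦ ⟪derivKernel n t, f⟫`: the count is Crofton's formula
for the curve `derivKernel n`.

Replace zeros by sign changes on the grid of step `h = 2π / 2^m`. Two vectors of equal length at
angle `a` have inner products of opposite signs with a fraction `a / π` of the sphere
(`toSphere_oppositeSigns`). As `⟪derivKernel n s, derivKernel n t⟫` depends only on `s - t`, all
grid steps subtend the same angle, and the mean number of sign changes is `2^m` times that angle
over `π` (`lintegral_gridCount`). It tends to the length of the normalized curve over `π`, which is
`2 √(∑ k⁴ / ∑ k²)`.

Off a null set all zeros are simple and miss every grid (`ae_nondegenerate`). Then the sign changes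
increase with `m` and are eventually equal in number to the zeros, so monotone convergence gives the
mean number of critical points. Power sums give the Bernoulli form and the asymptotics. -/

namespace RandomTrig

/-! ### Additive functions on an interval -/

/-- A nonnegative function on `(0, T]` that is additive there is linear. -/
theorem eq_div_mul_of_additive_of_nonneg {A : ℝ → ℝ} {T : ℝ} (hA : ∀ a, 0 ≤ A a)
    (hadd : ∀ a b, 0 < a → 0 < b → a + b ≤ T → A (a + b) = A a + A b)
    {a : ℝ} (ha : 0 < a) (haT : a ≤ T) : A a = a / T * A T := by
  have hT : 0 < T := ha.trans_le haT
  have hmul : ∀ (m : ℕ) (b : ℝ), 0 < b → (m + 1 : ℝ) * b ≤ T →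
      A ((m + 1 : ℝ) * b) = (m + 1 : ℝ) * A b := by
    intro m b hb
    induction m with
    | zero => simp
    | succ m ih =>
      intro h
      push_cast at h ⊢
      have h1 : ((m : ℝ) + 1 + 1) * b = (m + 1) * b + b := by ring
      rw [h1, hadd _ _ (by positivity) hb (by linarith), ih (by nlinarith)]
      ring
  have hle : ∀ b, 0 < b → b ≤ T → A b ≤ A T := by
    intro b hb hbT
    rcases hbT.eq_or_lt with rfl | hlt
    · exact le_rfl
    · have := hadd b (T - b) hb (by linarith) (by linarith)
      rw [add_sub_cancel] at this
      linarith [hA (T - b)]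
  have hup : ∀ a, 0 < a → a ≤ T → A a ≤ a / T * A T := by
    intro a ha haT
    -- With mesh `b = a / (k + 1)`, monotonicity at the largest multiple of `b` below `T` loses at
    -- most one `A b = A a / (k + 1)`; letting `k` grow removes this error.
    have key : ∀ k : ℕ, (k + 1 : ℝ) * (A a * (T / a) - A T) ≤ A a := by
      intro k
      have hb : 0 < a / (k + 1) := by positivity
      have h1 : A a = (k + 1) * A (a / (k + 1)) := by
        have := hmul k (a / (k + 1)) hb (by rw [mul_div_cancel₀ _ (by positivity)]; exact haT)
        rwa [mul_div_cancel₀ _ (by positivity)] at this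
      obtain ⟨m, hm⟩ : ∃ m : ℕ, ⌊T / (a / (k + 1))⌋₊ = m + 1 := by
        refine Nat.exists_eq_succ_of_ne_zero (Nat.pos_iff_ne_zero.1 (Nat.floor_pos.2 ?_))
        rw [le_div_iff₀ hb, one_mul]
        refine le_trans (div_le_self ha.le ?_) haT
        linarith [(Nat.cast_nonneg k : (0 : ℝ) ≤ k)]
      have h2 : ((m : ℝ) + 1) ≤ T / (a / (k + 1)) := by
        have := Nat.floor_le (a := T / (a / (k + 1))) (by positivity)
        rw [hm] at this
        exact_mod_cast this
      have h3 : T / (a / (k + 1)) < (m : ℝ) + 1 + 1 := by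
        have := Nat.lt_floor_add_one (T / (a / (k + 1)))
        rw [hm] at this
        exact_mod_cast this
      have h4 : ((m : ℝ) + 1) * (a / (k + 1)) ≤ T := (le_div_iff₀ hb).1 h2
      have h5 := hle _ (by positivity) h4
      rw [hmul m _ hb h4] at h5
      have h6 : T / (a / (k + 1)) = (k + 1) * (T / a) := by field_simp
      rw [h6] at h3
      have hk : (0 : ℝ) < k + 1 := by positivity
      have h7 : (k + 1) * (((m : ℝ) + 1) * A (a / (k + 1))) ≤ (k + 1) * A T :=
        mul_le_mul_of_nonneg_left h5 hk.le
      have h8 : A a * ((k + 1) * (T / a)) ≤ A a * ((m : ℝ) + 1 + 1) :=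
        mul_le_mul_of_nonneg_left h3.le (hA a)
      have h9 : (k + 1) * (((m : ℝ) + 1) * A (a / (k + 1))) = (m + 1) * A a := by
        rw [h1]; ring
      linarith
    have h0 : A a * (T / a) - A T ≤ 0 := by
      by_contra! h
      obtain ⟨k, hk⟩ := exists_nat_gt (A a / (A a * (T / a) - A T))
      rw [div_lt_iff₀ h] at hk
      nlinarith [key k]
    have h1 : A a = a / T * (A a * (T / a)) := by field_simp
    rw [h1]
    exact mul_le_mul_of_nonneg_left (by linarith) (by positivity)
  -- The upper bounds at `a` and `T - a` add up to `A T = A a + A (T - a)`, so both are equalities.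
  rcases haT.eq_or_lt with rfl | hlt
  · rw [div_self hT.ne', one_mul]
  · have h1 := hadd a (T - a) ha (by linarith) (by linarith)
    rw [add_sub_cancel] at h1
    have h2 := hup a ha haT
    have h3 := hup (T - a) (by linarith) (by linarith)
    have h4 : (T - a) / T * A T = A T - a / T * A T := by field_simp
    linarith

/-! ### Measure of the region where two linear functionals differ in sign -/

section SignChange

variable {E : Type*} [NormedAddCommGroup E] [InnerProductSpace ℝ E]

/-- The vectors whose inner products with `u` and `w` have opposite signs. -/
def oppositeSigns (u w : E) : Set E := {x | inner ℝ u x * inner ℝ w x < 0}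

theorem mem_oppositeSigns {u w x : E} :
    x ∈ oppositeSigns u w ↔ inner ℝ u x * inner ℝ w x < 0 := Iff.rfl

theorem isOpen_oppositeSigns (u w : E) : IsOpen (oppositeSigns u w) :=
  isOpen_lt (by fun_prop) continuous_const

theorem oppositeSigns_comm (u w : E) : oppositeSigns u w = oppositeSigns w u := by
  simp only [oppositeSigns, mul_comm]

theorem smul_mem_oppositeSigns_iff {u w x : E} {r : ℝ} (hr : 0 < r) :
    r • x ∈ oppositeSigns u w ↔ x ∈ oppositeSigns u w := by
  simp only [mem_oppositeSigns, inner_smul_right]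
  rw [show r * inner ℝ u x * (r * inner ℝ w x) = r ^ 2 * (inner ℝ u x * inner ℝ w x) by ring]
  exact ⟨fun h => by by_contra! h'; nlinarith [mul_nonneg (sq_nonneg r) h'],
    fun h => mul_neg_of_pos_of_neg (by positivity) h⟩

theorem oppositeSigns_smul_smul (u w : E) {r s : ℝ} (hr : 0 < r) (hs : 0 < s) :
    oppositeSigns (r • u) (s • w) = oppositeSigns u w := by
  ext x
  simp only [mem_oppositeSigns, inner_smul_left, conj_trivial]
  rw [show r * inner ℝ u x * (s * inner ℝ w x) = (r * s) * (inner ℝ u x * inner ℝ w x) by ring]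
  have : 0 < r * s := by positivity
  exact ⟨fun h => by by_contra! h'; nlinarith [mul_nonneg this.le h'],
    fun h => mul_neg_of_pos_of_neg this h⟩

/-- The point at angle `t` of the circle through the orthonormal vectors `u` and `w`. -/
noncomputable def circlePoint (u w : E) (t : ℝ) : E := Real.cos t • u + Real.sin t • w

theorem inner_circlePoint {u w : E} (hu : ‖u‖ = 1) (hw : ‖w‖ = 1) (huw : inner ℝ u w = 0)
    (s t : ℝ) : inner ℝ (circlePoint u w s) (circlePoint u w t) = Real.cos (s - t) := by
  have hwu : inner ℝ w u = 0 := by rw [real_inner_comm, huw]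
  simp only [circlePoint, inner_add_left, inner_add_right, inner_smul_left, inner_smul_right,
    real_inner_self_eq_norm_sq, hu, hw, huw, hwu, conj_trivial, Real.cos_sub]
  ring

theorem norm_circlePoint {u w : E} (hu : ‖u‖ = 1) (hw : ‖w‖ = 1) (huw : inner ℝ u w = 0)
    (t : ℝ) : ‖circlePoint u w t‖ = 1 := by
  have h := inner_circlePoint hu hw huw t t
  rw [sub_self, Real.cos_zero, real_inner_self_eq_norm_sq] at h
  nlinarith [norm_nonneg (circlePoint u w t)]

/-- This isometry reverses angles about `c / 2`; it makes `oppositeVolume` depend only on the angle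
between two points of the circle. -/
theorem reflection_circlePoint {u w : E} (hu : ‖u‖ = 1) (hw : ‖w‖ = 1) (huw : inner ℝ u w = 0)
    (c t : ℝ) : (Submodule.span ℝ {circlePoint u w (c / 2)}).reflection (circlePoint u w t) =
      circlePoint u w (c - t) := by
  rw [Submodule.reflection_singleton_apply, inner_circlePoint hu hw huw,
    norm_circlePoint hu hw huw]
  have hc : Real.cos (c - t) = 2 * Real.cos (c / 2 - t) * Real.cos (c / 2) - Real.cos t := by
    have h : Real.cos t = Real.cos (c / 2 - (c / 2 - t)) := by rw [sub_sub_cancel]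
    rw [show c - t = (c / 2 - t) + c / 2 by ring, Real.cos_add, h, Real.cos_sub (c / 2) (c / 2 - t)]
    ring
  have hs : Real.sin (c - t) = 2 * Real.cos (c / 2 - t) * Real.sin (c / 2) - Real.sin t := by
    have h : Real.sin t = Real.sin (c / 2 - (c / 2 - t)) := by rw [sub_sub_cancel]
    rw [show c - t = (c / 2 - t) + c / 2 by ring, Real.sin_add, h, Real.sin_sub (c / 2) (c / 2 - t)]
    ring
  simp only [circlePoint, hc, hs]
  norm_num
  module

variable [FiniteDimensional ℝ E] [MeasurableSpace E] [BorelSpace E]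

theorem volume_orthogonal_eq_zero {u : E} (hu : u ≠ 0) :
    volume {x : E | inner ℝ u x = 0} = 0 := by
  have h := Measure.addHaar_submodule (volume : Measure E) (Submodule.span ℝ {u})ᗮ (fun h => hu <| by
    have : u ∈ (Submodule.span ℝ {u})ᗮ := h ▸ Submodule.mem_top
    exact inner_self_eq_zero.1 (Submodule.mem_orthogonal_singleton_iff_inner_right.1 this))
  convert h using 2
  ext x
  exact Submodule.mem_orthogonal_singleton_iff_inner_right.symm

theorem ae_inner_ne_zero {u : E} (hu : u ≠ 0) : ∀ᵐ x : E, inner ℝ u x ≠ 0 := by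
  rw [ae_iff]
  simpa using volume_orthogonal_eq_zero hu

/-- The volume of the part of the unit ball where the inner products with `u` and `w` have opposite
signs. -/
noncomputable def oppositeVolume (u w : E) : ℝ :=
  volume.real (Metric.ball 0 1 ∩ oppositeSigns u w)

theorem oppositeVolume_comm (u w : E) : oppositeVolume u w = oppositeVolume w u := by
  rw [oppositeVolume, oppositeSigns_comm, oppositeVolume]

theorem oppositeVolume_map (φ : E ≃ₗᵢ[ℝ] E) (u w : E) :
    oppositeVolume (φ u) (φ w) = oppositeVolume u w := by
  have h := φ.measurePreserving.measure_preimage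
    (Metric.isOpen_ball.inter (isOpen_oppositeSigns (φ u) (φ w))
      : IsOpen (Metric.ball (0 : E) 1 ∩ _)).measurableSet.nullMeasurableSet
  have hpre : φ ⁻¹' (Metric.ball (0 : E) 1 ∩ oppositeSigns (φ u) (φ w)) =
      Metric.ball 0 1 ∩ oppositeSigns u w := by
    ext x
    simp [oppositeSigns]
  rw [oppositeVolume, oppositeVolume, measureReal_def, measureReal_def, ← h, hpre]

/-- The middle vector times `sin (a + b) ≥ 0` is a positive combination of the outer two, so when
the outer signs agree the middle sign agrees too. Off three null hyperplanes, the outer signs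
therefore differ exactly when one of the two adjacent pairs differs. At `a + b = π` the coefficient
vanishes and the outer signs are opposite. -/
theorem oppositeVolume_circlePoint_add {u w : E} (hu : ‖u‖ = 1) (hw : ‖w‖ = 1)
    (huw : inner ℝ u w = 0) {a b : ℝ} (ha : 0 < a) (hb : 0 < b) (hab : a + b ≤ π) :
    oppositeVolume (circlePoint u w 0) (circlePoint u w (a + b)) =
      oppositeVolume (circlePoint u w 0) (circlePoint u w a) +
        oppositeVolume (circlePoint u w 0) (circlePoint u w b) := by
  have hne : ∀ t, circlePoint u w t ≠ 0 := fun t h => by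
    have := norm_circlePoint hu hw huw t
    rw [h, norm_zero] at this
    exact zero_ne_one this
  have hrefl : oppositeVolume (circlePoint u w 0) (circlePoint u w b) =
      oppositeVolume (circlePoint u w a) (circlePoint u w (a + b)) := by
    rw [← oppositeVolume_map (Submodule.span ℝ {circlePoint u w ((a + b) / 2)}).reflection
      (circlePoint u w a), reflection_circlePoint hu hw huw, reflection_circlePoint hu hw huw,
      oppositeVolume_comm]
    congr 2 <;> ring
  have hpos1 : 0 < Real.sin a := Real.sin_pos_of_pos_of_lt_pi ha (by linarith)
  have hpos2 : 0 < Real.sin b := Real.sin_pos_of_pos_of_lt_pi hb (by linarith)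
  have hpos3 : 0 ≤ Real.sin (a + b) := Real.sin_nonneg_of_nonneg_of_le_pi (by linarith) hab
  have hrel : ∀ x : E, Real.sin (a + b) * inner ℝ (circlePoint u w a) x =
      Real.sin b * inner ℝ (circlePoint u w 0) x +
        Real.sin a * inner ℝ (circlePoint u w (a + b)) x := by
    intro x
    have h1 := Real.sin_sq_add_cos_sq a
    have h2 := Real.sin_sq_add_cos_sq b
    simp only [circlePoint, inner_add_left, inner_smul_left, conj_trivial, Real.sin_add,
      Real.cos_add, Real.cos_zero, Real.sin_zero]
    linear_combination (Real.sin b * inner ℝ u x) * h1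
  have hpn : ∀ {p q r : ℝ}, Real.sin (a + b) * q = Real.sin b * p + Real.sin a * r →
      0 < p → 0 < r → 0 < q := by
    intro p q r h hp hr
    have : 0 < Real.sin (a + b) * q := by rw [h]; positivity
    exact pos_of_mul_pos_right this hpos3
  have hnn : ∀ {p q r : ℝ}, Real.sin (a + b) * q = Real.sin b * p + Real.sin a * r →
      p < 0 → r < 0 → q < 0 := by
    intro p q r h hp hr
    have := hpn (p := -p) (q := -q) (r := -r) (by linarith) (neg_pos.2 hp) (neg_pos.2 hr)
    linarith
  have hdisj : Disjoint (Metric.ball 0 1 ∩ oppositeSigns (circlePoint u w 0) (circlePoint u w a))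
      (Metric.ball 0 1 ∩ oppositeSigns (circlePoint u w a) (circlePoint u w (a + b))) := by
    refine Set.disjoint_left.2 fun x h1 h2 => ?_
    rcases mul_neg_iff.1 (mem_oppositeSigns.1 h1.2) with h3 | h3 <;>
      rcases mul_neg_iff.1 (mem_oppositeSigns.1 h2.2) with h4 | h4
    · linarith
    · linarith [hpn (hrel x) h3.1 h4.2]
    · linarith [hnn (hrel x) h3.1 h4.2]
    · linarith
  have hfin : ∀ s : Set E, volume (Metric.ball 0 1 ∩ s) ≠ ⊤ := fun s =>
    (measure_ball_lt_top.trans_le' (measure_mono Set.inter_subset_left)).ne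
  rw [hrefl, oppositeVolume, oppositeVolume, oppositeVolume, ← measureReal_union hdisj
    (measurableSet_ball.inter (isOpen_oppositeSigns _ _).measurableSet) (hfin _) (hfin _)]
  refine measureReal_congr (Filter.eventuallyEq_set.2 ?_)
  filter_upwards [ae_inner_ne_zero (hne 0), ae_inner_ne_zero (hne a),
    ae_inner_ne_zero (hne (a + b))] with x h0 h1 h2
  simp only [mem_oppositeSigns, Set.mem_inter_iff, Set.mem_union, ← and_or_left,
    mul_neg_iff]
  refine and_congr_right fun _ => ?_
  have h3 := hpn (hrel x)
  have h4 := hnn (hrel x)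
  grind

theorem oppositeVolume_circlePoint {u w : E} (hu : ‖u‖ = 1) (hw : ‖w‖ = 1)
    (huw : inner ℝ u w = 0) {a : ℝ} (ha : 0 < a) (haπ : a ≤ π) :
    oppositeVolume (circlePoint u w 0) (circlePoint u w a) =
      a / π * volume.real (Metric.ball (0 : E) 1) := by
  rw [eq_div_mul_of_additive_of_nonneg
    (A := fun a => oppositeVolume (circlePoint u w 0) (circlePoint u w a)) (T := π)
    (fun _ => measureReal_nonneg)
    (fun a b ha hb hab => oppositeVolume_circlePoint_add hu hw huw ha hb hab) ha haπ]
  congr 1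
  -- At angle `π` the second vector is `-u`, so the signs differ off a hyperplane.
  have hu0 : u ≠ 0 := fun h => by simp [h] at hu
  refine measureReal_congr (Filter.eventuallyEq_set.2 ?_)
  filter_upwards [ae_inner_ne_zero hu0] with x hx
  simp [oppositeSigns, circlePoint, hx]

theorem oppositeVolume_eq {u w : E} {r a : ℝ} (hr : 0 < r) (hu : ‖u‖ = r) (hw : ‖w‖ = r)
    (ha : 0 < a) (haπ : a < π) (huw : inner ℝ u w = r ^ 2 * Real.cos a) :
    oppositeVolume u w = a / π * volume.real (Metric.ball (0 : E) 1) := by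
  have hs : 0 < Real.sin a := Real.sin_pos_of_pos_of_lt_pi ha haπ
  have hsc := Real.sin_sq_add_cos_sq a
  set u' : E := r⁻¹ • u with hu'
  -- Gram–Schmidt: `z` is chosen so that `r⁻¹ • w` is the point at angle `a` of the circle through
  -- `u'` and `z`.
  set z : E := (Real.sin a)⁻¹ • (r⁻¹ • w - Real.cos a • u') with hz
  have hun : ‖u'‖ = 1 := by
    rw [hu', norm_smul, hu, norm_inv, Real.norm_of_nonneg hr.le, inv_mul_cancel₀ hr.ne']
  have hwn : ‖r⁻¹ • w‖ = 1 := by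
    rw [norm_smul, hw, norm_inv, Real.norm_of_nonneg hr.le, inv_mul_cancel₀ hr.ne']
  have hin : inner ℝ u' (r⁻¹ • w) = Real.cos a := by
    rw [hu', inner_smul_left, inner_smul_right, huw, conj_trivial]
    field_simp
  have huz : inner ℝ u' z = 0 := by
    rw [hz, inner_smul_right, inner_sub_right, hin, inner_smul_right, real_inner_self_eq_norm_sq,
      hun]
    ring
  have hzn : ‖z‖ = 1 := by
    have : ‖r⁻¹ • w - Real.cos a • u'‖ ^ 2 = Real.sin a ^ 2 := by
      rw [norm_sub_sq_real, hwn, norm_smul (Real.cos a), hun, inner_smul_right, real_inner_comm, hin,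
        Real.norm_eq_abs, mul_one, sq_abs]
      linarith
    have h2 : ‖r⁻¹ • w - Real.cos a • u'‖ = Real.sin a :=
      (sq_eq_sq₀ (norm_nonneg _) hs.le).1 this
    rw [hz, norm_smul, h2, norm_inv, Real.norm_of_nonneg hs.le, inv_mul_cancel₀ hs.ne']
  have h := oppositeVolume_circlePoint hun hzn huz ha haπ.le
  have h0 : circlePoint u' z 0 = r⁻¹ • u := by simp [circlePoint, hu']
  have h1 : circlePoint u' z a = r⁻¹ • w := by
    rw [circlePoint, hz, smul_smul (Real.sin a), mul_inv_cancel₀ hs.ne', one_smul]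
    abel
  rw [h0, h1, oppositeVolume, oppositeSigns_smul_smul _ _ (inv_pos.2 hr) (inv_pos.2 hr)] at h
  exact h

open Pointwise in
/-- The area of the part of the unit sphere where the inner products with two vectors of equal
length have opposite signs is proportional to the angle between them. -/
theorem toSphere_oppositeSigns {u w : E} {r a : ℝ} (hr : 0 < r) (hu : ‖u‖ = r) (hw : ‖w‖ = r)
    (ha : 0 < a) (haπ : a < π) (huw : inner ℝ u w = r ^ 2 * Real.cos a) :
    (volume : Measure E).toSphere {x | (x : E) ∈ oppositeSigns u w} =
      ENNReal.ofReal (a / π) * (volume : Measure E).toSphere Set.univ := by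
  -- `toSphere` is the dimension times the volume of this cone; the factor is the same for the whole
  -- sphere. The origin causes no exception, since it lies outside `oppositeSigns u w`.
  have hset : Set.Ioo (0 : ℝ) 1 • (Subtype.val '' {x : Metric.sphere (0 : E) 1 | (x : E) ∈ oppositeSigns u w})
      = Metric.ball 0 1 ∩ oppositeSigns u w := by
    ext x
    constructor
    · rintro ⟨t, ht, _, ⟨y, hy, rfl⟩, rfl⟩
      refine ⟨?_, (smul_mem_oppositeSigns_iff ht.1).2 hy⟩
      simp [norm_smul, abs_of_pos ht.1, ht.2]
    · rintro ⟨h1, h2⟩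
      have hx : x ≠ 0 := by
        rintro rfl
        simp [oppositeSigns] at h2
      have hxn : 0 < ‖x‖ := norm_pos_iff.2 hx
      refine ⟨‖x‖, ⟨hxn, by simpa using h1⟩, ‖x‖⁻¹ • x, ⟨⟨‖x‖⁻¹ • x, ?_⟩, ?_, rfl⟩, ?_⟩
      · simp [norm_smul, hxn.ne']
      · exact (smul_mem_oppositeSigns_iff (inv_pos.2 hxn)).2 h2
      · simp [smul_smul, hxn.ne']
  have hmeas : MeasurableSet {x : Metric.sphere (0 : E) 1 | (x : E) ∈ oppositeSigns u w} :=
    ((isOpen_oppositeSigns u w).preimage continuous_subtype_val).measurableSet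
  rw [Measure.toSphere_apply' _ hmeas, hset, Measure.toSphere_apply_univ, mul_left_comm]
  congr 1
  have h := oppositeVolume_eq hr hu hw ha haπ huw
  rw [oppositeVolume, measureReal_def, measureReal_def] at h
  have hfin : volume (Metric.ball (0 : E) 1) ≠ ⊤ := measure_ball_lt_top.ne
  rw [← ENNReal.ofReal_toReal hfin, ← ENNReal.ofReal_mul (by positivity), ← h,
    ENNReal.ofReal_toReal]
  exact (measure_ball_lt_top.trans_le' (measure_mono Set.inter_subset_left)).ne

/-- A cone that is null in the ambient space is null on the sphere. -/
theorem toSphere_null_of_cone {D : Set E} (hD : volume D = 0) (hmeas : MeasurableSet D)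
    (hcone : ∀ x ∈ D, ∀ r : ℝ, r • x ∈ D) :
    ∀ᵐ x : Metric.sphere (0 : E) 1 ∂(volume : Measure E).toSphere, (x : E) ∉ D := by
  rw [ae_iff]
  simp only [not_not]
  change (volume : Measure E).toSphere (Subtype.val ⁻¹' D) = 0
  rw [Measure.toSphere_apply' _ (hmeas.preimage measurable_subtype_coe)]
  refine mul_eq_zero_of_right _ (measure_mono_null ?_ hD)
  rintro _ ⟨t, -, _, ⟨y, hy, rfl⟩, rfl⟩
  exact hcone _ hy t

end SignChange
end RandomTrig

/-! ### Counting simple zeros by sign changes on a grid -/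

namespace RandomTrig

/-- The number of sign changes of `g` along the `M` intervals of the grid of step `T / M` on
`[0, T]`. -/
noncomputable def signChanges (g : ℝ → ℝ) (T : ℝ) (M : ℕ) : ℕ :=
  ∑ j ∈ Finset.range M, if g (j * (T / M)) * g ((j + 1) * (T / M)) < 0 then 1 else 0

theorem sum_range_two_mul (F : ℕ → ℕ) (M : ℕ) :
    ∑ j ∈ Finset.range (2 * M), F j = ∑ j ∈ Finset.range M, (F (2 * j) + F (2 * j + 1)) := by
  induction M with
  | zero => simp
  | succ M ih => rw [mul_add, mul_one, Finset.sum_range_succ, Finset.sum_range_succ, ih,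
      Finset.sum_range_succ]; ring

/-- If the ends of an interval have opposite signs, a nonzero value at the midpoint differs in sign
from one of them. This is the monotonicity that monotone convergence uses. -/
theorem signChanges_le_two_mul {g : ℝ → ℝ} {T : ℝ} {M : ℕ} (hM : M ≠ 0)
    (hg : ∀ j : ℕ, g (j * (T / (2 * M : ℕ))) ≠ 0) :
    signChanges g T M ≤ signChanges g T (2 * M) := by
  rw [signChanges, signChanges, sum_range_two_mul]
  refine Finset.sum_le_sum fun j _ => ?_
  have hM' : (M : ℝ) ≠ 0 := by exact_mod_cast hM
  have h0 : ((2 * j : ℕ) : ℝ) * (T / (2 * M : ℕ)) = j * (T / M) := by push_cast; field_simp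
  have h1 : (((2 * j : ℕ) : ℝ) + 1) * (T / (2 * M : ℕ)) = ((2 * j + 1 : ℕ) : ℝ) * (T / (2 * M : ℕ)) := by
    push_cast; ring
  have h2 : (((2 * j + 1 : ℕ) : ℝ) + 1) * (T / (2 * M : ℕ)) = (j + 1) * (T / M) := by
    push_cast; field_simp; ring
  have hne := hg (2 * j + 1)
  rw [h0, h1, h2]
  simp only [mul_neg_iff]
  set y := g (((2 * j + 1 : ℕ) : ℝ) * (T / (2 * M : ℕ)))
  set x := g (j * (T / M))
  set z := g ((j + 1) * (T / M))
  rcases lt_or_gt_of_ne hne with h | h <;> split_ifs <;> grind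

/-- On an interval where `g` or its derivative has no zero, the number of zeros of `g` is `1` if `g`
changes sign and `0` otherwise. -/
theorem ncard_zeros_Ico {g g' : ℝ → ℝ} (hg : ∀ x, HasDerivAt g (g' x) x) {a b : ℝ} (hab : a < b)
    (ha : g a ≠ 0)
    (h : (∀ x ∈ Set.Icc a b, g x ≠ 0) ∨ ∀ x ∈ Set.Icc a b, g' x ≠ 0) :
    {x ∈ Set.Ico a b | g x = 0}.Finite ∧
      {x ∈ Set.Ico a b | g x = 0}.ncard = if g a * g b < 0 then 1 else 0 := by
  have hc : Continuous g := continuous_iff_continuousAt.2 fun x => (hg x).continuousAt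
  have hivt : g a * g b < 0 → ∃ x ∈ Set.Ioo a b, g x = 0 := by
    intro hlt
    rcases mul_neg_iff.1 hlt with h1 | h1
    · exact intermediate_value_Ioo' hab.le hc.continuousOn ⟨h1.2, h1.1⟩
    · exact intermediate_value_Ioo hab.le hc.continuousOn ⟨h1.1, h1.2⟩
  rcases h with h | h
  · have he : {x ∈ Set.Ico a b | g x = 0} = ∅ :=
      Set.eq_empty_of_forall_notMem fun x hx => h x ⟨hx.1.1, hx.1.2.le⟩ hx.2
    rw [he, if_neg fun hlt => ?_]
    · simp
    · obtain ⟨x, hx, hx0⟩ := hivt hlt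
      exact h x ⟨hx.1.le, hx.2.le⟩ hx0
  · have hinj : Set.InjOn g (Set.Icc a b) := by
      have : ∀ x ∈ Set.Icc a b, ∀ y ∈ Set.Icc a b, x < y → g x ≠ g y := by
        intro x hx y hy hxy he
        obtain ⟨c, hc1, hc2⟩ := exists_hasDerivAt_eq_zero hxy hc.continuousOn he fun z _ => hg z
        exact h c ⟨hx.1.trans hc1.1.le, hc1.2.le.trans hy.2⟩ hc2
      intro x hx y hy he
      rcases lt_trichotomy x y with hlt | heq | hlt
      · exact absurd he (this x hx y hy hlt)
      · exact heq
      · exact absurd he.symm (this y hy x hx hlt)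
    have hsub : {x ∈ Set.Ico a b | g x = 0}.Subsingleton := fun x hx y hy =>
      hinj ⟨hx.1.1, hx.1.2.le⟩ ⟨hy.1.1, hy.1.2.le⟩ (hx.2.trans hy.2.symm)
    refine ⟨hsub.finite, ?_⟩
    split_ifs with hlt
    · obtain ⟨x, hx, hx0⟩ := hivt hlt
      rw [hsub.eq_singleton_of_mem (x := x) ⟨⟨hx.1.le, hx.2⟩, hx0⟩, Set.ncard_singleton]
    · rw [Set.ncard_eq_zero hsub.finite]
      refine Set.eq_empty_of_forall_notMem fun x hx => hlt ?_
      have hxa : a < x := lt_of_le_of_ne hx.1.1 fun he => ha (he ▸ hx.2)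
      have hxI : x ∈ Set.Icc a b := ⟨hx.1.1, hx.1.2.le⟩
      -- Injectivity makes `g` strictly monotone, so a zero strictly between `a` and `b` forces
      -- opposite signs at the ends.
      rcases hc.continuousOn.strictMonoOn_of_injOn_Icc' hab.le hinj with hm | hm
      · have h1 := hm (Set.left_mem_Icc.2 hab.le) hxI hxa
        have h2 := hm hxI (Set.right_mem_Icc.2 hab.le) hx.1.2
        rw [hx.2] at h1 h2
        exact mul_neg_of_neg_of_pos h1 h2
      · have h1 := hm (Set.left_mem_Icc.2 hab.le) hxI hxa
        have h2 := hm hxI (Set.right_mem_Icc.2 hab.le) hx.1.2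
        rw [hx.2] at h1 h2
        exact mul_neg_of_pos_of_neg h1 h2

/-- `δ` is a Lebesgue number of the cover of `[0, T]` by `{g ≠ 0}` and `{g' ≠ 0}`, which is a cover
because zeros are simple. -/
theorem exists_uniform_zero_free {g g' : ℝ → ℝ} (hg : Continuous g) (hg' : Continuous g')
    (hsimple : ∀ x, g x = 0 → g' x ≠ 0) (T : ℝ) :
    ∃ δ > 0, ∀ a ∈ Set.Icc 0 T, ∀ b < a + δ,
      (∀ x ∈ Set.Icc a b, g x ≠ 0) ∨ ∀ x ∈ Set.Icc a b, g' x ≠ 0 := by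
  obtain ⟨δ, hδ, h⟩ := lebesgue_number_lemma_of_metric (isCompact_Icc (a := (0 : ℝ)) (b := T))
    (c := fun i : Bool => if i then {x | g x ≠ 0} else {x | g' x ≠ 0}) (by
      rintro (_ | _)
      · simpa using isOpen_ne_fun hg' continuous_const
      · simpa using isOpen_ne_fun hg continuous_const) (by
      intro x _
      by_cases hx : g x = 0
      · exact Set.mem_iUnion.2 ⟨false, by simpa using hsimple x hx⟩
      · exact Set.mem_iUnion.2 ⟨true, by simpa using hx⟩)
  refine ⟨δ, hδ, fun a ha b hb => ?_⟩
  obtain ⟨i, hi⟩ := h a ha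
  have hball : ∀ x ∈ Set.Icc a b, x ∈ Metric.ball a δ := fun x hx => by
    rw [Metric.mem_ball, Real.dist_eq, abs_of_nonneg (by linarith [hx.1])]
    linarith [hx.2]
  rcases i with _ | _
  · exact Or.inr fun x hx => by simpa using hi (hball x hx)
  · exact Or.inl fun x hx => by simpa using hi (hball x hx)

/-- The partial unions of the grid intervals exhaust the zeros. -/
theorem ncard_zeros_eq_sum {g : ℝ → ℝ} {s : ℝ} (hs : 0 < s) (c : ℕ → ℕ) (M : ℕ)
    (h : ∀ j < M, {x ∈ Set.Ico (j * s) ((j + 1) * s) | g x = 0}.Finite ∧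
      {x ∈ Set.Ico (j * s) ((j + 1) * s) | g x = 0}.ncard = c j) :
    {x ∈ Set.Ico 0 (M * s) | g x = 0}.Finite ∧
      {x ∈ Set.Ico 0 (M * s) | g x = 0}.ncard = ∑ j ∈ Finset.range M, c j := by
  induction M with
  | zero => simp
  | succ M ih =>
    obtain ⟨ih1, ih2⟩ := ih fun j hj => h j (by omega)
    obtain ⟨h1, h2⟩ := h M (by omega)
    have hu : {x ∈ Set.Ico 0 (((M + 1 : ℕ) : ℝ) * s) | g x = 0} =
        {x ∈ Set.Ico 0 (M * s) | g x = 0} ∪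
          {x ∈ Set.Ico (M * s) ((M + 1) * s) | g x = 0} := by
      rw [Nat.cast_succ, ← Set.Ico_union_Ico_eq_Ico (b := (M : ℝ) * s) (by positivity) (by nlinarith)]
      ext x
      simp only [Set.mem_ofPred_eq, Set.mem_union, or_and_right]
    rw [hu]
    refine ⟨ih1.union h1, ?_⟩
    rw [Set.ncard_union_eq ?_ ih1 h1, ih2, h2, Finset.sum_range_succ]
    exact Set.disjoint_left.2 fun x hx hx' => (hx.1.2.trans_le hx'.1.1).false

/-- If all zeros of `g` are simple and none lies on the grids, then on fine grids the number of sign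
changes of `g` is its number of zeros. -/
theorem eventually_signChanges_eq {g g' : ℝ → ℝ} (hg : ∀ x, HasDerivAt g (g' x) x)
    (hg' : Continuous g') (hsimple : ∀ x, g x = 0 → g' x ≠ 0) {T : ℝ} (hT : 0 < T)
    (hgrid : ∀ m j : ℕ, g (j * (T / (2 ^ m : ℕ))) ≠ 0) :
    {x ∈ Set.Ico 0 T | g x = 0}.Finite ∧
      ∀ᶠ m : ℕ in atTop, signChanges g T (2 ^ m) = {x ∈ Set.Ico 0 T | g x = 0}.ncard := by
  have hc : Continuous g := continuous_iff_continuousAt.2 fun x => (hg x).continuousAt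
  obtain ⟨δ, hδ, h⟩ := exists_uniform_zero_free hc hg' hsimple T
  have hkey : ∀ᶠ m : ℕ in atTop, {x ∈ Set.Ico 0 T | g x = 0}.Finite ∧
      {x ∈ Set.Ico 0 T | g x = 0}.ncard = signChanges g T (2 ^ m) := by
    have ht : Tendsto (fun m : ℕ => T / ((2 ^ m : ℕ) : ℝ)) atTop (𝓝 0) := by
      refine Tendsto.div_atTop tendsto_const_nhds (tendsto_natCast_atTop_atTop.comp ?_)
      exact tendsto_pow_atTop_atTop_of_one_lt one_lt_two
    filter_upwards [ht.eventually (gt_mem_nhds hδ)] with m hm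
    have hs : 0 < T / ((2 ^ m : ℕ) : ℝ) := by positivity
    have hMs : ((2 ^ m : ℕ) : ℝ) * (T / ((2 ^ m : ℕ) : ℝ)) = T := by
      rw [mul_div_cancel₀]
      positivity
    have := ncard_zeros_eq_sum (g := g) hs
      (fun j => if g (j * (T / (2 ^ m : ℕ))) * g ((j + 1) * (T / (2 ^ m : ℕ))) < 0 then 1 else 0)
      (2 ^ m) (by
        intro j hj
        refine ncard_zeros_Ico hg (by nlinarith) (hgrid m j)
          (h _ ⟨by positivity, ?_⟩ _ (by linarith))
        exact (mul_le_mul_of_nonneg_right (Nat.cast_le.2 hj.le) hs.le).trans_eq hMs)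
    rwa [hMs] at this
  obtain ⟨m, hm⟩ := hkey.exists
  exact ⟨hm.1, hkey.mono fun m hm => hm.2.symm⟩

end RandomTrig

/-! ### Trigonometric basis and the representers of `f'(t)` and `f''(t)` -/

namespace RandomTrig
namespace TrigPoly

/-- Evaluation at a point of the circle as a linear functional. -/
noncomputable def evalLinear (n : ℕ) (z : Circle) : TrigPoly n →ₗ[ℝ] ℝ where
  toFun f := f z
  map_add' _ _ := rfl
  map_smul' _ _ := rfl

theorem sum_apply {n : ℕ} {ι : Type*} (s : Finset ι) (f : ι → TrigPoly n) (z : Circle) :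
    (∑ i ∈ s, f i) z = ∑ i ∈ s, f i z :=
  map_sum (evalLinear n z) f s

theorem cos_mul_arg_exp (k : ℕ) (c θ : ℝ) :
    Real.cos (k * Complex.arg (Circle.exp θ : ℂ) + c) = Real.cos (k * θ + c) := by
  obtain ⟨m, hm⟩ := Circle.exp_eq_exp.1 (Circle.exp_arg (Circle.exp θ))
  rw [hm, show k * (θ + m * (2 * π)) + c = k * θ + c + ((k * m : ℤ) : ℝ) * (2 * π) by
    push_cast; ring, Real.cos_add_int_mul_two_pi]

theorem cos_mem_trigSubmodule {n k : ℕ} (h : k ≤ n) (c : ℝ) :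
    (fun z : Circle => Real.cos (k * Complex.arg (z : ℂ) + c)) ∈ trigSubmodule n := by
  refine ⟨fun j => if j = k then Real.cos c else 0, fun j => if j = k then -Real.sin c else 0,
    fun θ => (cos_mul_arg_exp k c θ).trans ?_⟩
  simp only [ite_mul, zero_mul, Finset.sum_add_distrib, Finset.sum_ite_eq',
    Finset.mem_Icc, h, and_true, Real.cos_add]
  rcases Nat.eq_zero_or_pos k with rfl | hk
  · simp
  · simp only [if_neg hk.ne, if_pos (Nat.one_le_iff_ne_zero.2 hk.ne')]
    ring

/-- The element `θ ↦ cos (kθ + c)` of `V_n` for `k ≤ n`, and `0` for `k > n`. -/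
noncomputable def wave (n k : ℕ) (c : ℝ) : TrigPoly n :=
  if h : k ≤ n then Subtype.mk _ (cos_mem_trigSubmodule h c) else 0

theorem wave_exp {n k : ℕ} (hk : k ≤ n) (c θ : ℝ) :
    wave n k c (Circle.exp θ) = Real.cos (k * θ + c) := by
  have h : wave n k c = Subtype.mk _ (cos_mem_trigSubmodule hk c) := dif_pos hk
  rw [h]
  exact cos_mul_arg_exp k c θ

theorem ext_exp {n : ℕ} {f g : TrigPoly n}
    (h : ∀ θ : ℝ, f (Circle.exp θ) = g (Circle.exp θ)) : f = g :=
  TrigPoly.ext fun z => by rw [← Circle.exp_arg z]; exact h _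

theorem integral_cos_int_mul_add (m : ℤ) (c : ℝ) :
    ∫ θ in (0 : ℝ)..(2 * π), Real.cos (m * θ + c) = if m = 0 then 2 * π * Real.cos c else 0 := by
  split_ifs with h
  · simp [h]
  · have hm : (m : ℝ) ≠ 0 := by exact_mod_cast h
    rw [intervalIntegral.integral_comp_mul_add _ hm, integral_cos, mul_zero, zero_add,
      add_comm ((m : ℝ) * _), Real.sin_add_int_mul_two_pi, sub_self, smul_zero]

/-- Product-to-sum: only a zero frequency survives integration, and `1 ≤ k` keeps `k + j` nonzero.
-/
theorem inner_wave_wave {n k j : ℕ} (hk : k ≤ n) (hj : j ≤ n) (hk1 : 1 ≤ k) (c d : ℝ) :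
    inner ℝ (wave n k c) (wave n j d) = if k = j then Real.cos (c - d) / 2 else 0 := by
  have hπ := Real.pi_pos
  have h : ∀ θ : ℝ, wave n k c (Circle.exp θ) * wave n j d (Circle.exp θ) =
      2⁻¹ * (Real.cos (((k - j : ℤ) : ℝ) * θ + (c - d)) +
        Real.cos (((k + j : ℤ) : ℝ) * θ + (c + d))) := by
    intro θ
    rw [wave_exp hk, wave_exp hj,
      show ((k - j : ℤ) : ℝ) * θ + (c - d) = (k * θ + c) - (j * θ + d) by push_cast; ring,
      show ((k + j : ℤ) : ℝ) * θ + (c + d) = (k * θ + c) + (j * θ + d) by push_cast; ring,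
      Real.cos_add (k * θ + c), Real.cos_sub (k * θ + c)]
    ring
  simp only [inner_def, h]
  rw [intervalIntegral.integral_const_mul, intervalIntegral.integral_add
    (Continuous.intervalIntegrable (by fun_prop) _ _)
    (Continuous.intervalIntegrable (by fun_prop) _ _), integral_cos_int_mul_add,
    integral_cos_int_mul_add, if_neg (by omega : ¬ (k + j : ℤ) = 0)]
  by_cases hkj : k = j
  · rw [if_pos (by omega), if_pos hkj]
    field_simp
    ring
  · rw [if_neg (by omega), if_neg hkj]
    ring

/-- The representer of `f ↦ f'(t)`. -/
noncomputable def derivKernel (n : ℕ) (t : ℝ) : TrigPoly n :=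
  -- As a function of `θ` this is `∑ 2k sin (k (θ - t))`: phase `-π/2` gives `sin kθ`, and the
  -- factor `2` offsets the squared norm `1/2` of a wave.
  ∑ k ∈ Finset.Icc 1 n, (2 * k : ℝ) •
    (Real.cos (k * t) • wave n k (-(π / 2)) - Real.sin (k * t) • wave n k 0)

/-- The representer of `f ↦ f''(t)`. -/
noncomputable def secondDerivKernel (n : ℕ) (t : ℝ) : TrigPoly n :=
  ∑ k ∈ Finset.Icc 1 n, (2 * k : ℝ) •
    ((-Real.sin (k * t) * k) • wave n k (-(π / 2)) - (Real.cos (k * t) * k) • wave n k 0)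

theorem hasDerivAt_derivKernel (n : ℕ) (t : ℝ) :
    HasDerivAt (derivKernel n) (secondDerivKernel n t) t := by
  refine HasDerivAt.fun_sum fun k _ => HasDerivAt.fun_const_smul _ (HasDerivAt.fun_sub ?_ ?_)
  · have := ((hasDerivAt_id t).const_mul (k : ℝ)).cos
    simp only [id, mul_one] at this
    exact this.smul_const _
  · have := ((hasDerivAt_id t).const_mul (k : ℝ)).sin
    simp only [id, mul_one] at this
    exact this.smul_const _

theorem contDiff_derivKernel (n : ℕ) : ContDiff ℝ 1 (derivKernel n) := by
  unfold derivKernel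
  fun_prop

theorem contDiff_secondDerivKernel (n : ℕ) : ContDiff ℝ 1 (secondDerivKernel n) := by
  unfold secondDerivKernel
  fun_prop

theorem exists_expansion {n : ℕ} (f : TrigPoly n) : ∃ a b : ℕ → ℝ,
    (∀ θ : ℝ, f (Circle.exp θ) =
      a 0 + ∑ k ∈ Finset.Icc 1 n, (a k * Real.cos (k * θ) + b k * Real.sin (k * θ))) ∧
    f = a 0 • wave n 0 0 +
      ∑ k ∈ Finset.Icc 1 n, (a k • wave n k 0 + b k • wave n k (-(π / 2))) := by
  obtain ⟨a, b, h⟩ := f.2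
  refine ⟨a, b, h, ext_exp fun θ => (h θ).trans ?_⟩
  rw [add_apply, sum_apply, smul_apply, wave_exp (Nat.zero_le n)]
  simp only [CharP.cast_eq_zero, zero_mul, zero_add, Real.cos_zero, mul_one]
  congr 1
  refine Finset.sum_congr rfl fun k hk => ?_
  have hk' := (Finset.mem_Icc.1 hk).2
  rw [add_apply, smul_apply, smul_apply, wave_exp hk', wave_exp hk', add_zero,
    ← sub_eq_add_neg, Real.cos_sub_pi_div_two]

theorem inner_wave_eq {n k : ℕ} (hk : k ∈ Finset.Icc 1 n) (c : ℝ) (a b : ℕ → ℝ) :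
    inner ℝ (wave n k c) (a 0 • wave n 0 0 +
      ∑ k ∈ Finset.Icc 1 n, (a k • wave n k 0 + b k • wave n k (-(π / 2)))) =
      (a k * Real.cos c - b k * Real.sin c) / 2 := by
  obtain ⟨h1, h2⟩ := Finset.mem_Icc.1 hk
  rw [inner_add_right, inner_smul_right, inner_wave_wave h2 (Nat.zero_le n) h1,
    if_neg (by omega), inner_sum, Finset.sum_eq_single_of_mem k hk]
  · rw [inner_add_right, inner_smul_right, inner_smul_right, inner_wave_wave h2 h2 h1,
      inner_wave_wave h2 h2 h1, if_pos rfl, if_pos rfl, sub_zero, sub_neg_eq_add,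
      Real.cos_add_pi_div_two]
    ring
  · intro j hj hjk
    rw [inner_add_right, inner_smul_right, inner_smul_right,
      inner_wave_wave h2 (Finset.mem_Icc.1 hj).2 h1, inner_wave_wave h2 (Finset.mem_Icc.1 hj).2 h1,
      if_neg hjk.symm, if_neg hjk.symm]
    ring

theorem hasDerivAt_exp {n : ℕ} (f : TrigPoly n) (t : ℝ) :
    HasDerivAt (fun θ : ℝ => f (Circle.exp θ)) (inner ℝ (derivKernel n t) f) t := by
  obtain ⟨a, b, h, hf⟩ := exists_expansion f
  have hval : inner ℝ (derivKernel n t) f = ∑ k ∈ Finset.Icc 1 n,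
      (a k * (-Real.sin (k * t) * k) + b k * (Real.cos (k * t) * k)) := by
    rw [derivKernel, sum_inner]
    refine Finset.sum_congr rfl fun k hk => ?_
    rw [inner_smul_left, inner_sub_left, inner_smul_left, inner_smul_left]
    have hin : ∀ c, inner ℝ (wave n k c) f = (a k * Real.cos c - b k * Real.sin c) / 2 :=
      fun c => by rw [← inner_wave_eq hk, ← hf]
    rw [hin, hin]
    simp
    ring
  rw [hval, funext h]
  refine HasDerivAt.const_add _ (HasDerivAt.fun_sum fun k _ => HasDerivAt.fun_add ?_ ?_)
  · have := ((hasDerivAt_id t).const_mul (k : ℝ)).cos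
    simp only [id, mul_one] at this
    exact this.const_mul _
  · have := ((hasDerivAt_id t).const_mul (k : ℝ)).sin
    simp only [id, mul_one] at this
    exact this.const_mul _

theorem hasDerivAt_inner_derivKernel {n : ℕ} (f : TrigPoly n) (t : ℝ) :
    HasDerivAt (fun θ : ℝ => inner ℝ (derivKernel n θ) f)
      (inner ℝ (secondDerivKernel n t) f) t := by
  simpa using (hasDerivAt_derivKernel n t).inner ℝ (hasDerivAt_const t f)

/-- By the reproducing property this is the derivative of the wave at `t`, so no integral is needed.
-/
theorem inner_derivKernel_wave {n k : ℕ} (hk : k ≤ n) (c t : ℝ) :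
    inner ℝ (derivKernel n t) (wave n k c) = -Real.sin (k * t + c) * k := by
  refine (hasDerivAt_exp (wave n k c) t).unique ?_
  simp only [wave_exp hk]
  simpa using (((hasDerivAt_id t).const_mul (k : ℝ)).add_const c).cos

theorem inner_secondDerivKernel_wave {n k : ℕ} (hk : k ≤ n) (c t : ℝ) :
    inner ℝ (secondDerivKernel n t) (wave n k c) = -(Real.cos (k * t + c) * k) * k := by
  refine (hasDerivAt_inner_derivKernel (wave n k c) t).unique ?_
  simp only [inner_derivKernel_wave hk]
  have := (((hasDerivAt_id t).const_mul (k : ℝ)).add_const c).sin.neg.mul_const (k : ℝ)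
  simpa using this

theorem inner_derivKernel_derivKernel (n : ℕ) (s t : ℝ) :
    inner ℝ (derivKernel n s) (derivKernel n t) =
      ∑ k ∈ Finset.Icc 1 n, 2 * (k : ℝ) ^ 2 * Real.cos (k * (s - t)) := by
  nth_rw 2 [derivKernel]
  rw [inner_sum]
  refine Finset.sum_congr rfl fun k hk => ?_
  have hk' := (Finset.mem_Icc.1 hk).2
  rw [inner_smul_right, inner_sub_right, inner_smul_right, inner_smul_right,
    inner_derivKernel_wave hk', inner_derivKernel_wave hk', mul_sub (k : ℝ), Real.cos_sub, add_zero,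
    ← sub_eq_add_neg, Real.sin_sub_pi_div_two]
  ring

theorem norm_derivKernel (n : ℕ) (t : ℝ) :
    ‖derivKernel n t‖ = √(2 * ∑ k ∈ Finset.Icc 1 n, (k : ℝ) ^ 2) := by
  rw [← Real.sqrt_sq (norm_nonneg _), ← real_inner_self_eq_norm_sq,
    inner_derivKernel_derivKernel, Finset.mul_sum]
  simp

/-! ### Degenerate critical points are negligible -/

/-- The trigonometric polynomials with a degenerate critical point. -/
def degenerate (n : ℕ) : Set (TrigPoly n) :=
  {f | ∃ t : ℝ, inner ℝ (derivKernel n t) f = 0 ∧ inner ℝ (secondDerivKernel n t) f = 0}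

/-- The incidence set in `ℝ × V_n` is closed, hence σ-compact, and so is its projection. -/
theorem measurableSet_degenerate (n : ℕ) : MeasurableSet (degenerate n) := by
  have hclosed : IsClosed {p : ℝ × TrigPoly n | inner ℝ (derivKernel n p.1) p.2 = 0 ∧
      inner ℝ (secondDerivKernel n p.1) p.2 = 0} := by
    have h1 := (contDiff_derivKernel n).continuous
    have h2 := (contDiff_secondDerivKernel n).continuous
    exact (isClosed_eq (by fun_prop) continuous_const).inter
      (isClosed_eq (by fun_prop) continuous_const)
  obtain ⟨K, hK, hKu⟩ := (isSigmaCompact_univ.of_isClosed_subset hclosed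
    (Set.subset_univ _)).image continuous_snd
  have : degenerate n = ⋃ i, K i := by
    rw [hKu]
    ext f
    simp [degenerate]
  rw [this]
  exact MeasurableSet.iUnion fun i => (hK i).measurableSet

theorem smul_mem_degenerate {n : ℕ} {f : TrigPoly n} (hf : f ∈ degenerate n) (r : ℝ) :
    r • f ∈ degenerate n := by
  obtain ⟨t, h1, h2⟩ := hf
  exact ⟨t, by rw [inner_smul_right, h1, mul_zero], by rw [inner_smul_right, h2, mul_zero]⟩

theorem volume_eq_zero_of_dimH_lt {E : Type*} [NormedAddCommGroup E] [InnerProductSpace ℝ E]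
    [FiniteDimensional ℝ E] [MeasurableSpace E] [BorelSpace E] {s : Set E}
    (hs : dimH s < Module.finrank ℝ E) : volume s = 0 := by
  have h : μH[((Module.finrank ℝ E : NNReal) : ℝ)] s = 0 :=
    hausdorffMeasure_of_dimH_lt (by simpa using hs)
  simp only [NNReal.coe_natCast] at h
  exact Measure.absolutelyContinuous_isAddHaarMeasure volume μH[(Module.finrank ℝ E : ℝ)] h

/-- On the span of `cos θ` and `sin θ` the map `f ↦ (f'(t), f''(t))` is a rotation for every `t`. So
`t` and the component of `f` in the orthogonal complement `Q` determine a degenerate `f`, and the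
set lies in a `C¹` image of `ℝ × Q`, whose dimension is one less than that of `V_n`. -/
theorem volume_degenerate {n : ℕ} (hn : 1 ≤ n) : volume (degenerate n) = 0 := by
  set C := wave n 1 0 with hC
  set S := wave n 1 (-(π / 2)) with hS
  set Q : Submodule ℝ (TrigPoly n) := (Submodule.span ℝ (Set.range ![C, S]))ᗮ with hQ
  have hCe : ∀ θ, C (Circle.exp θ) = Real.cos θ := fun θ => by simp [hC, wave_exp hn]
  have hSe : ∀ θ, S (Circle.exp θ) = Real.sin θ := fun θ => by
    simp [hS, wave_exp hn, ← sub_eq_add_neg, Real.cos_sub_pi_div_two]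
  have hli : LinearIndependent ℝ ![C, S] := by
    refine LinearIndependent.pair_iff.2 fun a b h => ?_
    have h' : ∀ θ, a * Real.cos θ + b * Real.sin θ = 0 := fun θ => by
      have := congrArg (fun f : TrigPoly n => f (Circle.exp θ)) h
      simpa [hCe, hSe] using this
    exact ⟨by simpa using h' 0, by simpa using h' (π / 2)⟩
  have hdim : Module.finrank ℝ Q + 2 = Module.finrank ℝ (TrigPoly n) := by
    have h1 := Submodule.finrank_add_finrank_orthogonal (Submodule.span ℝ (Set.range ![C, S]))
    rw [finrank_span_eq_card hli, Fintype.card_fin] at h1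
    rw [← h1, add_comm]
  have hvC : ∀ t, inner ℝ (derivKernel n t) C = -Real.sin t := fun t => by
    simp [hC, inner_derivKernel_wave hn]
  have hwC : ∀ t, inner ℝ (secondDerivKernel n t) C = -Real.cos t := fun t => by
    simp [hC, inner_secondDerivKernel_wave hn]
  have hvS : ∀ t, inner ℝ (derivKernel n t) S = Real.cos t := fun t => by
    simp [hS, inner_derivKernel_wave hn, ← sub_eq_add_neg, Real.sin_sub_pi_div_two]
  have hwS : ∀ t, inner ℝ (secondDerivKernel n t) S = -Real.sin t := fun t => by
    simp [hS, inner_secondDerivKernel_wave hn, ← sub_eq_add_neg, Real.cos_sub_pi_div_two]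
  -- The coefficients of `C` and `S` solve `f'(t) = f''(t) = 0` by inverting that rotation.
  let F : ℝ × Q → TrigPoly n := fun p => (p.2 : TrigPoly n) +
    ((Real.sin p.1 * inner ℝ (derivKernel n p.1) (p.2 : TrigPoly n) +
      Real.cos p.1 * inner ℝ (secondDerivKernel n p.1) (p.2 : TrigPoly n)) • C +
    (Real.sin p.1 * inner ℝ (secondDerivKernel n p.1) (p.2 : TrigPoly n) -
      Real.cos p.1 * inner ℝ (derivKernel n p.1) (p.2 : TrigPoly n)) • S)
  have hF : ContDiff ℝ 1 F := by
    have h0 : ContDiff ℝ 1 fun p : ℝ × Q => (p.2 : TrigPoly n) :=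
      Q.subtypeL.contDiff.comp contDiff_snd
    have h1 : ContDiff ℝ 1 fun p : ℝ × Q => inner ℝ (derivKernel n p.1) (p.2 : TrigPoly n) :=
      ((contDiff_derivKernel n).comp contDiff_fst).inner ℝ h0
    have h2 : ContDiff ℝ 1 fun p : ℝ × Q => inner ℝ (secondDerivKernel n p.1) (p.2 : TrigPoly n) :=
      ((contDiff_secondDerivKernel n).comp contDiff_fst).inner ℝ h0
    fun_prop
  have hsub : degenerate n ⊆ Set.range F := by
    rintro f ⟨t, h1, h2⟩
    obtain ⟨y, hy, q, hq, rfl⟩ :=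
      (Submodule.span ℝ (Set.range ![C, S])).exists_add_mem_mem_orthogonal f
    obtain ⟨a, b, rfl⟩ : ∃ a b : ℝ, a • C + b • S = y := by
      rw [Matrix.range_cons, Matrix.range_cons, Matrix.range_empty, Set.union_empty,
        Set.singleton_union] at hy
      exact Submodule.mem_span_pair.1 hy
    refine ⟨(t, ⟨q, hq⟩), ?_⟩
    simp only [inner_add_right, inner_smul_right, hvC, hvS, hwC, hwS] at h1 h2
    have hsc := Real.sin_sq_add_cos_sq t
    have ha : Real.sin t * inner ℝ (derivKernel n t) q +
        Real.cos t * inner ℝ (secondDerivKernel n t) q = a := by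
      linear_combination Real.sin t * h1 + Real.cos t * h2 + a * hsc
    have hb : Real.sin t * inner ℝ (secondDerivKernel n t) q -
        Real.cos t * inner ℝ (derivKernel n t) q = b := by
      linear_combination Real.sin t * h2 - Real.cos t * h1 + b * hsc
    simp only [F, ha, hb]
    abel
  refine measure_mono_null hsub (volume_eq_zero_of_dimH_lt (hF.dimH_range_le.trans_lt ?_))
  rw [Module.finrank_prod, Module.finrank_self, ← hdim]
  exact_mod_cast by omega

end TrigPoly
end RandomTrig

/-! ### Critical points, grid counts and their mean -/

namespace RandomTrig
namespace TrigPoly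

theorem exp_mem_criticalPoints_iff {n : ℕ} (f : TrigPoly n) (θ : ℝ) :
    Circle.exp θ ∈ criticalPoints f ↔ inner ℝ (derivKernel n θ) f = 0 := by
  have h : HasDerivAt (fun t : ℝ => f (Circle.exp θ * Circle.exp t))
      (inner ℝ (derivKernel n θ) f) 0 := by
    simp only [← Circle.exp_add]
    exact HasDerivAt.comp_const_add θ 0 (by simpa using hasDerivAt_exp f θ)
  refine ⟨fun h' => h.unique h', fun h' => ?_⟩
  rw [h'] at h
  exact h

theorem criticalPoints_eq_image {n : ℕ} (f : TrigPoly n) : criticalPoints f =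
    Circle.exp '' {x ∈ Set.Ico 0 (2 * π) | inner ℝ (derivKernel n x) f = 0} := by
  ext z
  constructor
  · intro hz
    obtain ⟨y, hy, hyt⟩ := Circle.periodic_exp.exists_mem_Ico₀ Real.two_pi_pos
      (Complex.arg (z : ℂ))
    rw [Circle.exp_arg] at hyt
    subst hyt
    exact ⟨y, ⟨hy, (exp_mem_criticalPoints_iff f y).1 hz⟩, rfl⟩
  · rintro ⟨x, hx, rfl⟩
    exact (exp_mem_criticalPoints_iff f x).2 hx.2

theorem injOn_exp_Ico : Set.InjOn Circle.exp (Set.Ico 0 (2 * π)) :=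
  Circle.exp_injOn_of_forall_sub_mem_Ioo fun x hx y hy => by
    constructor <;> linarith [hx.1, hx.2, hy.1, hy.2]

theorem ncard_criticalPoints {n : ℕ} (f : TrigPoly n) : (criticalPoints f).ncard =
    {x ∈ Set.Ico 0 (2 * π) | inner ℝ (derivKernel n x) f = 0}.ncard := by
  rw [criticalPoints_eq_image]
  exact (injOn_exp_Ico.mono fun x hx => hx.1).ncard_image

/-- Away from degenerate critical points and critical points on the grids, the critical points are
counted by the sign changes of the derivative. -/
theorem eventually_signChanges_eq_ncard {n : ℕ} {f : TrigPoly n} (hf : f ∉ degenerate n)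
    (hgrid : ∀ m j : ℕ, inner ℝ (derivKernel n (j * (2 * π / (2 ^ m : ℕ)))) f ≠ 0) :
    (criticalPoints f).Finite ∧ ∀ᶠ m : ℕ in atTop,
      signChanges (fun x => inner ℝ (derivKernel n x) f) (2 * π) (2 ^ m) =
        (criticalPoints f).ncard := by
  have hc := (contDiff_secondDerivKernel n).continuous
  have h := eventually_signChanges_eq (g := fun x => inner ℝ (derivKernel n x) f)
    (g' := fun x => inner ℝ (secondDerivKernel n x) f)
    (fun x => hasDerivAt_inner_derivKernel f x) (by fun_prop)
    (fun x h1 h2 => hf ⟨x, h1, h2⟩) Real.two_pi_pos hgrid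
  rw [ncard_criticalPoints]
  refine ⟨?_, h.2⟩
  rw [criticalPoints_eq_image]
  exact h.1.image _

theorem derivKernel_ne_zero {n : ℕ} (hn : 1 ≤ n) (t : ℝ) : derivKernel n t ≠ 0 := by
  rw [← norm_ne_zero_iff, norm_derivKernel]
  refine (Real.sqrt_pos.2 (mul_pos two_pos (Finset.sum_pos (fun k hk => ?_) ⟨1, by simp [hn]⟩))).ne'
  have : 0 < k := (Finset.mem_Icc.1 hk).1
  positivity

/-- The exceptional set is the degenerate cone together with countably many hyperplanes, one for
each grid point. -/
theorem ae_nondegenerate {n : ℕ} (hn : 1 ≤ n) :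
    ∀ᵐ f : UnitSphere n ∂(area n), (f : TrigPoly n) ∉ degenerate n ∧
      ∀ m j : ℕ, inner ℝ (derivKernel n (j * (2 * π / (2 ^ m : ℕ)))) (f : TrigPoly n) ≠ 0 := by
  have h1 := toSphere_null_of_cone (volume_degenerate hn) (measurableSet_degenerate n)
    fun f hf r => smul_mem_degenerate hf r
  have h2 : ∀ m j : ℕ, ∀ᵐ f : UnitSphere n ∂(area n),
      inner ℝ (derivKernel n (j * (2 * π / (2 ^ m : ℕ)))) (f : TrigPoly n) ≠ 0 := fun m j => by
    refine toSphere_null_of_cone (volume_orthogonal_eq_zero (derivKernel_ne_zero hn _))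
      (isClosed_eq (by fun_prop) continuous_const).measurableSet fun f hf r => ?_
    change inner ℝ _ (r • f) = 0
    rw [inner_smul_right, show inner ℝ _ f = 0 from hf, mul_zero]
  exact h1.and (ae_all_iff.2 fun m => ae_all_iff.2 fun j => h2 m j)

/-- Write `φ y = y * dslope φ 0 y`, where the slope tends to `1`. It serves for `sin` and for
`arcsin`. -/
theorem tendsto_mul_comp {φ : ℝ → ℝ} (hφ : HasDerivAt φ 1 0) (h0 : φ 0 = 0) {ι : Type*}
    {l : Filter ι} {c y : ι → ℝ} {a : ℝ} (hy : Tendsto y l (𝓝 0))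
    (hcy : Tendsto (fun i => c i * y i) l (𝓝 a)) :
    Tendsto (fun i => c i * φ (y i)) l (𝓝 a) := by
  have hd : Tendsto (fun i => dslope φ 0 (y i)) l (𝓝 1) := by
    have := (continuousAt_dslope_same.2 hφ.differentiableAt).tendsto
    rw [dslope_same, hφ.deriv] at this
    exact this.comp hy
  have h := hcy.mul hd
  rw [mul_one] at h
  refine h.congr fun i => ?_
  have := sub_smul_dslope φ 0 (y i)
  rw [h0, sub_zero, sub_zero, smul_eq_mul] at this
  rw [mul_assoc, this]

/-- The sine of half the angle between the values of `derivKernel n` at points at distance `h`. -/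
noncomputable def sinHalfAngle (n : ℕ) (h : ℝ) : ℝ :=
  √((∑ k ∈ Finset.Icc 1 n, (k : ℝ) ^ 2 * Real.sin (k * (h / 2)) ^ 2) /
    ∑ k ∈ Finset.Icc 1 n, (k : ℝ) ^ 2)

theorem sum_sq_pos {n : ℕ} (hn : 1 ≤ n) : 0 < ∑ k ∈ Finset.Icc 1 n, (k : ℝ) ^ 2 :=
  Finset.sum_pos (fun k hk => by
    have : 0 < k := (Finset.mem_Icc.1 hk).1
    positivity) ⟨1, by simp [hn]⟩

theorem sinHalfAngle_pos {n : ℕ} (hn : 1 ≤ n) {h : ℝ} (h0 : 0 < h) (h2 : h < 2 * π) :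
    0 < sinHalfAngle n h := by
  refine Real.sqrt_pos.2 (div_pos (Finset.sum_pos' (fun k _ => by positivity)
    ⟨1, by simp [hn], ?_⟩) (sum_sq_pos hn))
  have := Real.sin_pos_of_pos_of_lt_pi (x := h / 2) (by linarith) (by linarith)
  simp only [Nat.cast_one, one_mul, one_pow]
  positivity

/-- The identity `cos 2x = 1 - 2 sin² x` is applied to every summand and to the angle itself. Half
angles are used because `arcsin` is differentiable at `0`, while `arccos` is not at `1`. -/
theorem inner_derivKernel_eq_cos {n : ℕ} (hn : 1 ≤ n) {h : ℝ} (h1 : sinHalfAngle n h ≤ 1) (s : ℝ) :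
    inner ℝ (derivKernel n s) (derivKernel n (s + h)) =
      (√(2 * ∑ k ∈ Finset.Icc 1 n, (k : ℝ) ^ 2)) ^ 2 *
        Real.cos (2 * Real.arcsin (sinHalfAngle n h)) := by
  have hpos := sum_sq_pos hn
  have h0 : 0 ≤ sinHalfAngle n h := Real.sqrt_nonneg _
  rw [Real.sq_sqrt (by positivity), Real.cos_two_mul', Real.cos_sq',
    Real.sin_arcsin (by linarith) h1, sinHalfAngle, Real.sq_sqrt (by positivity),
    inner_derivKernel_derivKernel]
  have hterm : ∀ k ∈ Finset.Icc 1 n, 2 * (k : ℝ) ^ 2 * Real.cos (k * (s - (s + h))) =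
      2 * (k : ℝ) ^ 2 - 4 * ((k : ℝ) ^ 2 * Real.sin (k * (h / 2)) ^ 2) := by
    intro k _
    rw [show (k : ℝ) * (s - (s + h)) = -(2 * (k * (h / 2))) by ring, Real.cos_neg,
      Real.cos_two_mul', Real.cos_sq']
    ring
  rw [Finset.sum_congr rfl hterm, Finset.sum_sub_distrib, ← Finset.mul_sum, ← Finset.mul_sum]
  generalize ∑ k ∈ Finset.Icc 1 n, (k : ℝ) ^ 2 * Real.sin (k * (h / 2)) ^ 2 = B
  field_simp
  ring

theorem tendsto_two_pow : Tendsto (fun m : ℕ => ((2 ^ m : ℕ) : ℝ)) atTop atTop :=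
  tendsto_natCast_atTop_atTop.comp (tendsto_pow_atTop_atTop_of_one_lt one_lt_two)

/-- Since `2^m sin (kπ / 2^m) → kπ`, each weight `k²` acquires another `k²`, whence the fourth
powers. -/
theorem tendsto_mul_sinHalfAngle {n : ℕ} :
    Tendsto (fun m : ℕ => ((2 ^ m : ℕ) : ℝ) * sinHalfAngle n (2 * π / (2 ^ m : ℕ))) atTop
      (𝓝 (π * √((∑ k ∈ Finset.Icc 1 n, (k : ℝ) ^ 4) / ∑ k ∈ Finset.Icc 1 n, (k : ℝ) ^ 2))) := by
  have hsin : ∀ k : ℕ, Tendsto (fun m : ℕ => ((2 ^ m : ℕ) : ℝ) *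
      Real.sin (k * (2 * π / (2 ^ m : ℕ) / 2))) atTop (𝓝 (k * π)) := by
    intro k
    refine tendsto_mul_comp (by simpa using Real.hasDerivAt_sin 0) Real.sin_zero ?_ ?_
    · have := ((tendsto_const_nhds (x := 2 * π)).div_atTop tendsto_two_pow).div_const 2
      simpa using this.const_mul (k : ℝ)
    · refine tendsto_const_nhds.congr fun m => ?_
      field_simp
  have hsum : Tendsto (fun m : ℕ => (∑ k ∈ Finset.Icc 1 n, (k : ℝ) ^ 2 * (((2 ^ m : ℕ) : ℝ) *
      Real.sin (k * (2 * π / (2 ^ m : ℕ) / 2))) ^ 2) / ∑ k ∈ Finset.Icc 1 n, (k : ℝ) ^ 2) atTop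
      (𝓝 ((∑ k ∈ Finset.Icc 1 n, (k : ℝ) ^ 2 * (k * π) ^ 2) /
        ∑ k ∈ Finset.Icc 1 n, (k : ℝ) ^ 2)) :=
    (tendsto_finsetSum _ fun k _ => ((hsin k).pow 2).const_mul _).div_const _
  have hlim : π * √((∑ k ∈ Finset.Icc 1 n, (k : ℝ) ^ 4) / ∑ k ∈ Finset.Icc 1 n, (k : ℝ) ^ 2) =
      √((∑ k ∈ Finset.Icc 1 n, (k : ℝ) ^ 2 * (k * π) ^ 2) /
        ∑ k ∈ Finset.Icc 1 n, (k : ℝ) ^ 2) := by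
    nth_rw 1 [← Real.sqrt_sq Real.pi_pos.le]
    rw [← Real.sqrt_mul (sq_nonneg _), ← mul_div_assoc, Finset.mul_sum]
    congr 3 with k
    ring
  rw [hlim]
  refine hsum.sqrt.congr fun m => ?_
  rw [sinHalfAngle]
  nth_rw 3 [← Real.sqrt_sq (Nat.cast_nonneg (2 ^ m) : (0 : ℝ) ≤ _)]
  rw [← Real.sqrt_mul (sq_nonneg _), ← mul_div_assoc, Finset.mul_sum]
  congr 3 with k
  ring

theorem tendsto_sinHalfAngle {n : ℕ} :
    Tendsto (fun m : ℕ => sinHalfAngle n (2 * π / (2 ^ m : ℕ))) atTop (𝓝 0) := by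
  refine ((tendsto_mul_sinHalfAngle (n := n)).div_atTop tendsto_two_pow).congr fun m => ?_
  field_simp

/-- The number of sign changes of the derivative of `f` on the grid with `2 ^ m` points. -/
noncomputable def gridCount (n m : ℕ) (f : UnitSphere n) : ℕ :=
  signChanges (fun x => inner ℝ (derivKernel n x) (f : TrigPoly n)) (2 * π) (2 ^ m)

theorem coe_gridCount (n m : ℕ) (f : UnitSphere n) : (gridCount n m f : ENNReal) =
    ∑ j ∈ Finset.range (2 ^ m), Set.indicator {f : UnitSphere n | (f : TrigPoly n) ∈
      oppositeSigns (derivKernel n (j * (2 * π / (2 ^ m : ℕ))))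
        (derivKernel n ((j + 1) * (2 * π / (2 ^ m : ℕ))))} (1 : UnitSphere n → ENNReal) f := by
  simp only [gridCount, signChanges, Nat.cast_sum, Nat.cast_ite, Nat.cast_one, Nat.cast_zero,
    Set.indicator_apply, Set.mem_ofPred_eq, mem_oppositeSigns, Pi.one_apply]

theorem measurableSet_coe_mem_oppositeSigns {n : ℕ} (u w : TrigPoly n) :
    MeasurableSet {f : UnitSphere n | (f : TrigPoly n) ∈ oppositeSigns u w} :=
  ((isOpen_oppositeSigns u w).preimage continuous_subtype_val).measurableSet

theorem measurable_coe_gridCount (n m : ℕ) :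
    Measurable fun f : UnitSphere n => (gridCount n m f : ENNReal) := by
  simp only [coe_gridCount]
  exact Finset.measurable_sum _ fun j _ =>
    measurable_one.indicator (measurableSet_coe_mem_oppositeSigns _ _)

theorem lintegral_gridCount {n : ℕ} (hn : 1 ≤ n) {m : ℕ} (hm : 1 ≤ m)
    (h1 : sinHalfAngle n (2 * π / (2 ^ m : ℕ)) < 1) :
    ∫⁻ f, (gridCount n m f : ENNReal) ∂(area n) = ENNReal.ofReal
      (((2 ^ m : ℕ) : ℝ) * (2 * Real.arcsin (sinHalfAngle n (2 * π / (2 ^ m : ℕ))) / π)) *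
        area n Set.univ := by
  have hπ := Real.pi_pos
  -- For `m ≥ 1` the step is less than `2π`, so consecutive kernels are at a positive angle; `h1`
  -- keeps that angle below `π`.
  have hM : (1 : ℝ) < (2 ^ m : ℕ) := by exact_mod_cast Nat.one_lt_two_pow (by omega)
  have hpos := sinHalfAngle_pos hn (h := 2 * π / (2 ^ m : ℕ)) (by positivity)
    (div_lt_self (by positivity) hM)
  simp only [coe_gridCount]
  rw [lintegral_finsetSum _ fun j _ =>
    measurable_one.indicator (measurableSet_coe_mem_oppositeSigns _ _)]
  have hj : ∀ j ∈ Finset.range (2 ^ m), ∫⁻ f, Set.indicator {f : UnitSphere n | (f : TrigPoly n) ∈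
      oppositeSigns (derivKernel n (j * (2 * π / (2 ^ m : ℕ))))
        (derivKernel n ((j + 1) * (2 * π / (2 ^ m : ℕ))))} (1 : UnitSphere n → ENNReal) f ∂(area n) =
      ENNReal.ofReal (2 * Real.arcsin (sinHalfAngle n (2 * π / (2 ^ m : ℕ))) / π) *
        area n Set.univ := by
    intro j _
    rw [lintegral_indicator_one (measurableSet_coe_mem_oppositeSigns _ _)]
    refine toSphere_oppositeSigns (Real.sqrt_pos.2 (mul_pos two_pos (sum_sq_pos hn)))
      (norm_derivKernel _ _) (norm_derivKernel _ _)
      (mul_pos two_pos (Real.arcsin_pos.2 hpos)) ?_ ?_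
    · linarith [Real.arcsin_lt_pi_div_two.2 h1]
    · rw [add_mul, one_mul]
      exact inner_derivKernel_eq_cos hn h1.le _
  rw [Finset.sum_congr rfl hj, Finset.sum_const, Finset.card_range, nsmul_eq_mul, ← mul_assoc,
    ENNReal.ofReal_mul (Nat.cast_nonneg _), ENNReal.ofReal_natCast]

theorem tendsto_lintegral_gridCount {n : ℕ} (hn : 1 ≤ n) :
    Tendsto (fun m => ∫⁻ f, (gridCount n m f : ENNReal) ∂(area n)) atTop
      (𝓝 (ENNReal.ofReal (2 * √((∑ k ∈ Finset.Icc 1 n, (k : ℝ) ^ 4) /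
        ∑ k ∈ Finset.Icc 1 n, (k : ℝ) ^ 2)) * area n Set.univ)) := by
  have hfin : area n Set.univ ≠ ⊤ := by
    unfold area
    exact measure_ne_top _ _
  have harc : Tendsto (fun m : ℕ => ((2 ^ m : ℕ) : ℝ) *
      (2 * Real.arcsin (sinHalfAngle n (2 * π / (2 ^ m : ℕ))) / π)) atTop
      (𝓝 (2 * √((∑ k ∈ Finset.Icc 1 n, (k : ℝ) ^ 4) / ∑ k ∈ Finset.Icc 1 n, (k : ℝ) ^ 2))) := by
    have hd : HasDerivAt Real.arcsin 1 0 := by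
      simpa using Real.hasDerivAt_arcsin (x := 0) (by norm_num) (by norm_num)
    have h := (tendsto_mul_comp hd Real.arcsin_zero tendsto_sinHalfAngle
      (tendsto_mul_sinHalfAngle (n := n))).const_mul (2 / π)
    rw [← mul_assoc, div_mul_cancel₀ _ Real.pi_ne_zero] at h
    exact h.congr fun m => by ring
  refine (ENNReal.Tendsto.mul_const (ENNReal.tendsto_ofReal harc) (Or.inr hfin)).congr' ?_
  filter_upwards [tendsto_sinHalfAngle.eventually (gt_mem_nhds one_pos),
    eventually_ge_atTop 1] with m h1 hm
  exact (lintegral_gridCount hn hm h1).symm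

/-- `ncard` gives an infinite critical set the value `0`; this can happen only on the null set left
out here. -/
theorem ae_tendsto_gridCount {n : ℕ} (hn : 1 ≤ n) : ∀ᵐ f : UnitSphere n ∂(area n),
    Tendsto (fun m => (gridCount n m f : ENNReal)) atTop (𝓝 (numCrit n f : ENNReal)) := by
  filter_upwards [ae_nondegenerate hn] with f hf
  refine tendsto_const_nhds.congr' ?_
  filter_upwards [(eventually_signChanges_eq_ncard hf.1 hf.2).2] with m hm
  rw [gridCount, hm, numCrit]

theorem ae_monotone_gridCount {n : ℕ} (hn : 1 ≤ n) : ∀ᵐ f : UnitSphere n ∂(area n),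
    Monotone fun m => (gridCount n m f : ENNReal) := by
  filter_upwards [ae_nondegenerate hn] with f hf
  refine monotone_nat_of_le_succ fun m => Nat.cast_le.2 ?_
  have h := signChanges_le_two_mul (g := fun x => inner ℝ (derivKernel n x) (f : TrigPoly n))
    (T := 2 * π) (M := 2 ^ m) (by positivity) (fun j => by
      rw [← pow_succ']
      exact hf.2 (m + 1) j)
  rwa [← pow_succ'] at h

theorem lintegral_numCrit {n : ℕ} (hn : 1 ≤ n) :
    ∫⁻ f, (numCrit n f : ENNReal) ∂(area n) =
      ENNReal.ofReal (2 * √((∑ k ∈ Finset.Icc 1 n, (k : ℝ) ^ 4) /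
        ∑ k ∈ Finset.Icc 1 n, (k : ℝ) ^ 2)) * area n Set.univ :=
  tendsto_nhds_unique (lintegral_tendsto_of_tendsto_of_monotone
    (fun m => (measurable_coe_gridCount n m).aemeasurable) (ae_monotone_gridCount hn)
    (ae_tendsto_gridCount hn)) (tendsto_lintegral_gridCount hn)

theorem aemeasurable_numCrit {n : ℕ} (hn : 1 ≤ n) :
    AEMeasurable (fun f => (numCrit n f : ENNReal)) (area n) :=
  aemeasurable_of_tendsto_metrizable_ae atTop
    (fun m => (measurable_coe_gridCount n m).aemeasurable) (ae_tendsto_gridCount hn)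

theorem lintegral_numCrit_ne_top {n : ℕ} (hn : 1 ≤ n) :
    ∫⁻ f, (numCrit n f : ENNReal) ∂(area n) ≠ ⊤ := by
  rw [lintegral_numCrit hn, area]
  exact ENNReal.mul_ne_top ENNReal.ofReal_ne_top (measure_ne_top _ _)

theorem integrable_numCrit {n : ℕ} (hn : 1 ≤ n) :
    Integrable (fun f => (numCrit n f : ℝ)) (area n) := by
  simpa using integrable_toReal_of_lintegral_ne_top (aemeasurable_numCrit hn)
    (lintegral_numCrit_ne_top hn)

theorem expectedNumCrit_eq {n : ℕ} (hn : 1 ≤ n) : expectedNumCrit n =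
    2 * √((∑ k ∈ Finset.Icc 1 n, (k : ℝ) ^ 4) / ∑ k ∈ Finset.Icc 1 n, (k : ℝ) ^ 2) := by
  have hint := integral_toReal (aemeasurable_numCrit hn)
    (ae_of_all _ fun f => ENNReal.natCast_lt_top (numCrit n f))
  simp only [ENNReal.toReal_natCast] at hint
  have : Nontrivial (TrigPoly n) := ⟨⟨derivKernel n 0, 0, derivKernel_ne_zero hn 0⟩⟩
  have harea : (area n).real Set.univ ≠ 0 := by
    rw [area, measureReal_def, ENNReal.toReal_ne_zero]
    exact ⟨(Measure.measure_univ_ne_zero).2 (Measure.toSphere_ne_zero _), measure_ne_top _ _⟩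
  rw [expectedNumCrit, hint, lintegral_numCrit hn, ENNReal.toReal_mul,
    ENNReal.toReal_ofReal (by positivity), ← measureReal_def]
  field_simp

end TrigPoly
end RandomTrig

/-! ### Power sums, Bernoulli polynomials and asymptotics -/

namespace RandomTrig

/-- Faulhaber's formula, whose constant term is the Bernoulli number assumed to vanish. The argument
is `n + 1` because the sum includes `k = n`. -/
theorem mul_sum_Icc_pow_eq_bernoulliFun (n : ℕ) {p : ℕ} (hp : p ≠ 0)
    (hb : bernoulli (p + 1) = 0) :
    ((p : ℝ) + 1) * ∑ k ∈ Finset.Icc 1 n, (k : ℝ) ^ p = bernoulliFun (p + 1) ((n : ℝ) + 1) := by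
  have h := Polynomial.sum_range_pow_eq_bernoulli_sub (n + 1) p
  rw [Nat.succ_eq_add_one, hb, sub_zero] at h
  have h' := congrArg (algebraMap ℚ ℝ) h
  rw [← Polynomial.eval_map_apply] at h'
  have hs : ∑ k ∈ Finset.Icc 1 n, (k : ℝ) ^ p = ∑ k ∈ Finset.range (n + 1), (k : ℝ) ^ p := by
    rw [Finset.range_eq_Ico, Finset.sum_eq_sum_Ico_succ_bot (Nat.succ_pos n), Nat.cast_zero,
      zero_pow hp, zero_add, zero_add]
    rfl
  rw [hs, bernoulliFun]
  simpa using h'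

theorem sum_Icc_sq (n : ℕ) :
    ∑ k ∈ Finset.Icc 1 n, (k : ℝ) ^ 2 = (n : ℝ) * (n + 1) * (2 * n + 1) / 6 := by
  induction n with
  | zero => simp
  | succ n ih =>
    rw [Finset.sum_Icc_succ_top (by omega), ih]
    push_cast
    ring

theorem sum_Icc_pow_four (n : ℕ) : ∑ k ∈ Finset.Icc 1 n, (k : ℝ) ^ 4 =
    (n : ℝ) * (n + 1) * (2 * n + 1) * (3 * n ^ 2 + 3 * n - 1) / 30 := by
  induction n with
  | zero => simp
  | succ n ih =>
    rw [Finset.sum_Icc_succ_top (by omega), ih]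
    push_cast
    ring

theorem sum_pow_four_div_sum_sq {n : ℕ} (hn : 1 ≤ n) :
    (∑ k ∈ Finset.Icc 1 n, (k : ℝ) ^ 4) / ∑ k ∈ Finset.Icc 1 n, (k : ℝ) ^ 2 =
      (n : ℝ) ^ 2 * (3 / 5) * (1 + (n : ℝ)⁻¹ - (n : ℝ)⁻¹ ^ 2 / 3) := by
  have : (0 : ℝ) < n := by exact_mod_cast hn
  rw [sum_Icc_sq, sum_Icc_pow_four]
  field_simp
  ring

theorem isEquivalent_expectedNumCrit :
    Asymptotics.IsEquivalent atTop expectedNumCrit (fun n : ℕ => 2 * (n : ℝ) * √(3 / 5)) := by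
  have h35 : 0 < √(3 / 5 : ℝ) := Real.sqrt_pos.2 (by norm_num)
  rw [Asymptotics.isEquivalent_iff_tendsto_one]
  · have h0 := tendsto_inv_atTop_nhds_zero_nat (𝕜 := ℝ)
    have h1 : Tendsto (fun n : ℕ => √(1 + (n : ℝ)⁻¹ - (n : ℝ)⁻¹ ^ 2 / 3)) atTop (𝓝 1) := by
      simpa using (((h0.const_add 1).sub ((h0.pow 2).div_const 3))).sqrt
    refine h1.congr' ?_
    filter_upwards [eventually_ge_atTop 1] with n hn
    have hpos : (0 : ℝ) < n := by exact_mod_cast hn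
    rw [Pi.div_apply, TrigPoly.expectedNumCrit_eq hn, sum_pow_four_div_sum_sq hn,
      Real.sqrt_mul (by positivity), Real.sqrt_mul (by positivity), Real.sqrt_sq hpos.le]
    field_simp
  · filter_upwards [eventually_ge_atTop 1] with n hn
    have hpos : (0 : ℝ) < n := by exact_mod_cast hn
    positivity

end RandomTrig

theorem theorem4p1 :
    (∀ n : ℕ, 1 ≤ n →
      (∀ᵐ f : RandomTrig.UnitSphere n ∂(RandomTrig.area n),
        (RandomTrig.criticalPoints (f : RandomTrig.TrigPoly n)).Finite) ∧
      Integrable (fun f => (RandomTrig.numCrit n f : ℝ)) (RandomTrig.area n) ∧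
      RandomTrig.expectedNumCrit n =
        2 * √((∑ k ∈ Finset.Icc 1 n, (k : ℝ) ^ 4) / (∑ k ∈ Finset.Icc 1 n, (k : ℝ) ^ 2)) ∧
      RandomTrig.expectedNumCrit n =
        2 * √((3 * bernoulliFun 5 ((n : ℝ) + 1)) / (5 * bernoulliFun 3 ((n : ℝ) + 1)))) ∧
    Asymptotics.IsEquivalent atTop RandomTrig.expectedNumCrit
      (fun n : ℕ => 2 * (n : ℝ) * √(3 / 5)) := by
  refine ⟨fun n hn => ⟨?_, RandomTrig.TrigPoly.integrable_numCrit hn,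
    RandomTrig.TrigPoly.expectedNumCrit_eq hn, ?_⟩, RandomTrig.isEquivalent_expectedNumCrit⟩
  · filter_upwards [RandomTrig.TrigPoly.ae_nondegenerate hn] with f hf
    exact (RandomTrig.TrigPoly.eventually_signChanges_eq_ncard hf.1 hf.2).1
  -- The indices `5` and `3` are odd and exceed `1`, so their Bernoulli numbers vanish; the factors
  -- `5` and `3` are the `p + 1` of Faulhaber's formula.
  · rw [RandomTrig.TrigPoly.expectedNumCrit_eq hn,
      ← RandomTrig.mul_sum_Icc_pow_eq_bernoulliFun n (p := 4) (by norm_num)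
        (bernoulli_eq_zero_of_odd (by decide) (by norm_num)),
      ← RandomTrig.mul_sum_Icc_pow_eq_bernoulliFun n (p := 2) (by norm_num)
        (bernoulli_eq_zero_of_odd (by decide) (by norm_num))]
    have := RandomTrig.TrigPoly.sum_sq_pos hn
    congr 2
    push_cast
    field_simp
    ring
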